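/- Let configurations $\underline s\in\{0,1\}^{\mathbb Z}$ evolve under the rule 54 reversible cellular automaton: for $t=0,1,2,\dots$, $$s^{t+1}_x=\begin{cases}\chi(s^t_{x-1},s^t_x,s^t_{x+1}), & x+t\equiv 0 \pmod 2,\\ s^t_x, & x+t\equiv 1\pmod 2,\end{cases}\qquad \chi(a,b,c)=a+b+c+ac \pmod 2 .$$ Let $\langle\cdot\rangle$ be the expectation over initial configurations $\underline s^0$ in the maximum entropy state, i.e. the $s^0_x$, $x\in\mathbb Z$, are independent and uniform on $\{0,1\}$. Define the dynamic structure factor $$C(x,t)=\langle s^0_x\, s^t_0\rangle-\langle s^0_x\rangle\langle s^t_0\rangle\qquad (x\in\mathbb Z,\ t\in\mathbb N_0),$$ and, for $n\in\mathbb Z$, $$c_0(n)=\tfrac14\Bigl(1+\tfrac{i}{\sqrt7}\Bigr)\Bigl(\tfrac{-1-i\sqrt7}{2}\Bigr)^{n}+\tfrac14\Bigl(1-\tfrac{i}{\sqrt7}\Bigr)\Bigl(\tfrac{-1+i\sqrt7}{2}\Bigr)^{n}.$$ 1. For all $x\in\mathbb Z$ and $t\in\mathbb N_0$ with $x+t$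 even and $|x|\ge \frac{t+4}{3}$, $$2^{t+1}C(x,t)=\sum_{n=t-|x|+1}^{\frac32(t-|x|)}\Biggl(\prod_{\substack{j=t-|x|+1\\ j\ne n}}^{\frac32(t-|x|)}\frac{t-j}{n-j}\Biggr)c_0(n),$$ where the sum is empty, hence $0$, if $t\le|x|$. That is, $2^{t+1}C(x,t)$ is the value at $t$ of the Lagrange interpolation of $c_0$ over the nodes $t-|x|+1,\dots,\frac32(t-|x|)$. 2. Consequently, along rays at fixed distance from the edge of the light cone, $2^{t+1}C(x,t)$ is a polynomial in $t$: for every integer $k\ge1$ there is a real polynomial $P_k$ of degree exactly $k-1$, with $P_k(n)=c_0(n)$ for $n=2k+1,\dots,3k$, such that $2^{t+1}C(x,t)=P_k(t)$ for all $x\in\mathbb Z$, $t\in\mathbb N_0$ with $t-|x|=2k$ and $|x|\ge\frac{t+4}{3}$. (Here $k-1=\frac12(t-|x|-2)$.) -/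

import Mathlib

open MeasureTheory

noncomputable section

namespace RCA54

/-- Configurations of the chain: `s x = 1` if the site `x` is occupied, `s x = 0` if it is empty. -/
abbrev Config : Type := ℤ → ZMod 2

/-- The local rule `χ(s₁, s₂, s₃) = s₁ + s₂ + s₃ + s₁ s₃ (mod 2)`. -/
def chi (a b c : ZMod 2) : ZMod 2 := a + b + c + a * c

/-- The update of all even sites. -/
def stepEven (s : Config) : Config :=
  fun x => if Even x then chi (s (x - 1)) (s x) (s (x + 1)) else s x

/-- The update of all odd sites. -/
def stepOdd (s : Config) : Config :=
  fun x => if Even x then s x else chi (s (x - 1)) (s x) (s (x + 1))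

/-- The configuration at time `t`, started from `s` at time `0`; the even sites are updated in
the step from `t` to `t + 1` when `t` is even, and the odd sites when `t` is odd. -/
def evolve : ℕ → Config → Config
  | 0, s => s
  | t + 1, s => if Even t then stepEven (evolve t s) else stepOdd (evolve t s)

/-- The local observable `[α]_x`, with `[α]_x(s) = 1` if `s x = α` and `0` otherwise. -/
def site (α : ZMod 2) (x : ℤ) (s : Config) : ℝ := if s x = α then 1 else 0

/-- The time-evolved observable `aᵗ`, given by `aᵗ(s⁰) = a(sᵗ)`. -/
def timeEvolved (a : Config → ℝ) (t : ℕ) (s : Config) : ℝ := a (evolve t s)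

/-- The separable state with one-site probability distributions `p x`. -/
def separableState (p : ℤ → PMF (ZMod 2)) : Measure Config :=
  Measure.infinitePi fun x => (p x).toMeasure

/-- The maximum entropy state: `p x 0 = p x 1 = 1/2` at every site `x`. -/
def maxEntropyState : Measure Config :=
  separableState fun _ => PMF.uniformOfFintype (ZMod 2)

/-- The dynamic structure factor
`C(x,t) = ⟨[1]_x [1]_0ᵗ⟩ - ⟨[1]_x⟩ ⟨[1]_0ᵗ⟩` in the maximum entropy state. -/
def structureFactor (x : ℤ) (t : ℕ) : ℝ :=
  (∫ s, site 1 x s * timeEvolved (site 1 0) t s ∂maxEntropyState)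
    - (∫ s, site 1 x s ∂maxEntropyState) * ∫ s, timeEvolved (site 1 0) t s ∂maxEntropyState

/-- The rescaled value `c₀(n)` of the correlations in the homogeneous regime. -/
def c0 (n : ℤ) : ℂ :=
  1 / 4 * (1 + Complex.I / (√7 : ℝ)) * ((-1 - Complex.I * (√7 : ℝ)) / 2) ^ n
    + 1 / 4 * (1 - Complex.I / (√7 : ℝ)) * ((-1 + Complex.I * (√7 : ℝ)) / 2) ^ n

/-- The interpolation nodes `t - |x| + 1, …, (3/2)(t - |x|)` (used for `t - |x|` even; empty when
`t ≤ |x|`). -/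
def nodes (x : ℤ) (t : ℕ) : Finset ℤ := Finset.Icc ((t : ℤ) - |x| + 1) (3 * ((t : ℤ) - |x|) / 2)

end RCA54

end

/-! Written with signs, C(x,t) is a quarter of the correlation between the sign at the source x and
the sign at the origin at time t. By reflection the source may sit at -|x|, to the left of the
origin. Space-time is sliced into light-like rows. Row j arises from row j+1 by updating single
sites from left to right, and each such update preserves the uniform measure, so every row is again
a string of independent fair bits.

A row that passes above the source is no longer independent of it to the right of x. What survives
is `integral_path_eq_zero_of_pattern`: a sign there, weighted by a function of the sites to its
left, has no correlation with the source if the weight vanishes whenever the two preceding bits are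
0, 1. Bit identities with such right-hand sides give the linear recursions `rowCorr_succ_of_lt` and,
with reflection about the source, `rowCorr_succ_self`.

For t = 2k+1+i and |x| = i+1 the rescaled correlation F(k,i) then satisfies F(k+1,i+1) = F(k+1,i) +
4F(k,i) with F(k,0) = c₀(2k+1), by `rowCorr_eq`. Its solution is a Newton expansion in binomials of
i, hence a polynomial of degree k-1 in t. The characteristic polynomial z²+z+2 of c₀ divides
z³-z²-4, so c₀(2k+1+i) obeys the same recursion and equals F(k,i) for i ≤ k. This covers the k nodes
2k+1, …, 3k, and degree k-1 makes the polynomial equal to its Lagrange interpolant. -/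

namespace RCA54

/-! ### The sign of a bit and site updates -/

/-- The sign `(-1) ^ b` of a bit. -/
noncomputable def sgn (b : ZMod 2) : ℝ := if b = 0 then 1 else -1

@[simp] lemma sgn_zero : sgn 0 = 1 := by simp [sgn]

@[simp] lemma sgn_one : sgn 1 = -1 := by simp [sgn]

lemma bit_cases (b : ZMod 2) : b = 0 ∨ b = 1 := by revert b; decide

lemma bit_one_add_one : (1 : ZMod 2) + 1 = 0 := by decide

lemma sgn_mul_self (b : ZMod 2) : sgn b * sgn b = 1 := by
  rcases bit_cases b with rfl | rfl <;> simp

lemma sgn_add_one (b : ZMod 2) : sgn (b + 1) = -sgn b := by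
  rcases bit_cases b with rfl | rfl <;> simp [bit_one_add_one]

@[fun_prop] lemma continuous_sgn : Continuous sgn := continuous_of_discreteTopology

lemma continuous_sgn_site {f : Config → Config} (hf : Continuous f) (y : ℤ) :
    Continuous fun s => sgn (f s y) :=
  continuous_sgn.comp ((continuous_apply y).comp hf)

lemma site_one_eq (y : ℤ) (s : Config) : site 1 y s = (1 - sgn (s y)) / 2 := by
  rcases bit_cases (s y) with h | h <;> simp [site, h]

/-- The flip of the site `y`. -/
def flipSite (y : ℤ) (s : Config) : Config := Function.update s y (s y + 1)

/-- The update of the single site `y` by the local rule. -/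
def updateSite (y : ℤ) (s : Config) : Config :=
  Function.update s y (chi (s (y - 1)) (s y) (s (y + 1)))

@[simp] lemma flipSite_self (y : ℤ) (s : Config) : flipSite y s y = s y + 1 := by simp [flipSite]

lemma flipSite_of_ne {y z : ℤ} (h : z ≠ y) (s : Config) : flipSite y s z = s z := by
  simp [flipSite, h]

lemma updateSite_self (y : ℤ) (s : Config) :
    updateSite y s y = chi (s (y - 1)) (s y) (s (y + 1)) := by simp [updateSite]

lemma updateSite_of_ne {y z : ℤ} (h : z ≠ y) (s : Config) : updateSite y s z = s z := by
  simp [updateSite, h]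

lemma continuous_chi : Continuous fun p : ZMod 2 × ZMod 2 × ZMod 2 => chi p.1 p.2.1 p.2.2 :=
  continuous_of_discreteTopology

lemma continuous_chi_comp {α : Type*} [TopologicalSpace α] {f g h : α → ZMod 2} (hf : Continuous f)
    (hg : Continuous g) (hh : Continuous h) : Continuous fun s => chi (f s) (g s) (h s) :=
  continuous_chi.comp (hf.prodMk (hg.prodMk hh))

lemma continuous_flipSite (y : ℤ) : Continuous (flipSite y) :=
  continuous_id.update y ((continuous_of_discreteTopology (f := fun b : ZMod 2 => b + 1)).comp
    (continuous_apply y))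

lemma continuous_updateSite (y : ℤ) : Continuous (updateSite y) :=
  continuous_id.update y
    (continuous_chi_comp (continuous_apply _) (continuous_apply _) (continuous_apply _))

/-! ### Invariance of the maximum entropy state -/

instance : IsProbabilityMeasure maxEntropyState := by
  unfold maxEntropyState separableState; infer_instance

/-- The configuration space is compact, so continuity settles all integrability questions below. -/
lemma continuous_integrable {f : Config → ℝ} (hf : Continuous f) :
    Integrable f maxEntropyState := by
  have := hf.integrable_of_hasCompactSupport (μ := maxEntropyState)
    (HasCompactSupport.of_compactSpace f)
  exact this

lemma measurePreserving_flipSite (y : ℤ) :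
    MeasurePreserving (flipSite y) maxEntropyState maxEntropyState := by
  refine ⟨(continuous_flipSite y).measurable, ?_⟩
  have h := Measure.infinitePi_map_pi
    (fun _ : ℤ => (PMF.uniformOfFintype (ZMod 2)).toMeasure)
    (f := fun z b => if z = y then b + 1 else b) (fun _ => measurable_from_top)
  have hf : flipSite y = fun (s : Config) z => if z = y then s z + 1 else s z := by
    ext s z
    by_cases hz : z = y
    · subst hz; simp
    · simp [hz, flipSite_of_ne]
  unfold maxEntropyState separableState
  rw [hf, h]
  congr 1
  ext1 z
  split_ifs
  · classical
    ext A hA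
    rw [Measure.map_apply measurable_from_top hA, PMF.toMeasure_uniformOfFintype_apply _ ?_,
      PMF.toMeasure_uniformOfFintype_apply _ hA]
    · congr 2
      exact Fintype.card_congr ((Equiv.addRight (1 : ZMod 2)).subtypeEquiv (fun _ => Iff.rfl))
    · trivial
  · exact Measure.map_id

lemma flipSite_flipSite (y : ℤ) (s : Config) : flipSite y (flipSite y s) = s := by
  ext z
  by_cases hz : z = y
  · subst hz; simp [add_assoc, bit_one_add_one]
  · simp [hz, flipSite_of_ne]

/-- An integral vanishes if its integrand is odd under the flip of one site. -/
lemma integral_eq_zero_of_flipSite (y : ℤ) {f : Config → ℝ} (h : ∀ s, f (flipSite y s) = -f s) :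
    ∫ s, f s ∂maxEntropyState = 0 := by
  have hemb : MeasurableEmbedding (flipSite y) :=
    (MeasurableEquiv.mk ⟨flipSite y, flipSite y, flipSite_flipSite y, flipSite_flipSite y⟩
      (continuous_flipSite y).measurable (continuous_flipSite y).measurable).measurableEmbedding
  have h1 := (measurePreserving_flipSite y).integral_comp hemb f
  simp only [h, integral_neg] at h1
  linarith

/-- The rule adds to the bit at `y` the disjunction of its neighbours: it is the identity when both
neighbours are empty and the flip of `y` otherwise, and the flip does not affect which case holds.
-/
lemma measurePreserving_updateSite (y : ℤ) :
    MeasurePreserving (updateSite y) maxEntropyState maxEntropyState := by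
  refine ⟨(continuous_updateSite y).measurable, ?_⟩
  ext B hB
  let A : Set Config := {s | s (y - 1) = 0 ∧ s (y + 1) = 0}
  have hA : MeasurableSet A :=
    (measurable_pi_apply (y - 1) (measurableSet_singleton 0)).inter
      (measurable_pi_apply (y + 1) (measurableSet_singleton 0))
  have hAf (s : Config) : flipSite y s ∈ A ↔ s ∈ A := by
    simp [A, flipSite_of_ne (show y - 1 ≠ y by omega), flipSite_of_ne (show y + 1 ≠ y by omega)]
  have hU1 (s : Config) (hs : s ∈ A) : updateSite y s = s := by
    simp [updateSite, chi, hs.1, hs.2]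
  have hU2 (s : Config) (hs : s ∉ A) : updateSite y s = flipSite y s := by
    unfold updateSite flipSite
    congr 1
    rcases bit_cases (s (y - 1)) with h1 | h1 <;> rcases bit_cases (s (y + 1)) with h2 | h2 <;>
      rcases bit_cases (s y) with h3 | h3 <;> simp [A, chi, h1, h2, h3] at hs ⊢ <;> decide
  have hU := (continuous_updateSite y).measurable hB
  rw [Measure.map_apply (continuous_updateSite y).measurable hB,
    ← measure_inter_add_sdiff _ hA, ← measure_inter_add_sdiff B hA]
  congr 1
  · congr 1
    ext s
    simp only [Set.mem_inter_iff, Set.mem_preimage]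
    refine and_congr_left fun hs => ?_
    rw [hU1 s hs]
  · rw [← (measurePreserving_flipSite y).measure_preimage (hB.diff hA).nullMeasurableSet]
    congr 1
    ext s
    simp only [Set.mem_sdiff, Set.mem_preimage, hAf]
    refine and_congr_left fun hs => ?_
    rw [hU2 s hs]

/-- The reflection of the chain about the site `a`. -/
def reflect (a : ℤ) (s : Config) : Config := fun y => s (2 * a - y)

lemma continuous_reflect (a : ℤ) : Continuous (reflect a) :=
  continuous_pi fun _ => continuous_apply _

lemma reflect_reflect (a : ℤ) (s : Config) : reflect a (reflect a s) = s := by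
  ext y; simp [reflect]

lemma measurePreserving_reflect (a : ℤ) :
    MeasurePreserving (reflect a) maxEntropyState maxEntropyState := by
  refine ⟨(continuous_reflect a).measurable, ?_⟩
  have h := Measure.infinitePi_map_piCongrLeft (X := fun _ : ℤ => ZMod 2)
    (fun _ : ℤ => (PMF.uniformOfFintype (ZMod 2)).toMeasure) (Equiv.subLeft (2 * a))
  unfold maxEntropyState separableState
  convert h using 2
  ext s y
  have hy := Equiv.piCongrLeft_apply_apply (fun _ : ℤ => ZMod 2) (Equiv.subLeft (2 * a)) s
    (2 * a - y)
  simp only [Equiv.subLeft_apply, sub_sub_cancel] at hy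
  rw [MeasurableEquiv.coe_piCongrLeft, hy]
  rfl

lemma integral_reflect (a : ℤ) (f : Config → ℝ) :
    ∫ s, f (reflect a s) ∂maxEntropyState = ∫ s, f s ∂maxEntropyState := by
  have hemb : MeasurableEmbedding (reflect a) :=
    (MeasurableEquiv.mk ⟨reflect a, reflect a, reflect_reflect a, reflect_reflect a⟩
      (continuous_reflect a).measurable (continuous_reflect a).measurable).measurableEmbedding
  exact (measurePreserving_reflect a).integral_comp hemb f

lemma evolve_reflect (a : ℤ) (t : ℕ) (s : Config) :
    evolve t (reflect a s) = reflect a (evolve t s) := by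
  induction t with
  | zero => rfl
  | succ t ih =>
    have hpar (y : ℤ) : Even (2 * a - y) ↔ Even y := by
      rw [Int.even_sub]; simp
    have hchi (b c d : ZMod 2) : chi b c d = chi d c b := by unfold chi; ring
    have e1 (y : ℤ) : 2 * a - (y - 1) = 2 * a - y + 1 := by ring
    have e2 (y : ℤ) : 2 * a - (y + 1) = 2 * a - y - 1 := by ring
    simp only [evolve, ih]
    split_ifs <;> ext y <;> simp only [stepEven, stepOdd, reflect, hpar, e1, e2] <;>
      split_ifs <;> first | rfl | exact hchi _ _ _

/-! ### Light-like rows -/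

/-- `row i j s` is the `i`-th site of the light-like row of the space-time lattice that starts at
the initial site `2 * j` and runs to the right. -/
def row : ℕ → ℤ → Config → ZMod 2
  | 0, j, s => s (2 * j)
  | 1, j, s => s (2 * j + 1)
  | i + 2, j, s => chi (row (i + 1) j s) (row i (j + 1) s) (row (i + 1) (j + 1) s)

/-- The configuration on the space-like path that follows the initial configuration up to the site
`2 * j` and the light-like row from there on. -/
def path (j : ℤ) (s : Config) : Config :=
  fun y => if y < 2 * j then s y else row (y - 2 * j).toNat j s

lemma path_add (j : ℤ) (i : ℕ) (s : Config) : path j s (2 * j + i) = row i j s := by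
  simp [path]

lemma path_of_lt {j y : ℤ} (h : y < 2 * j + 2) (s : Config) : path j s y = s y := by
  unfold path
  split_ifs with h1
  · rfl
  · obtain rfl | rfl : y = 2 * j ∨ y = 2 * j + 1 := by omega
    · simp [row]
    · simp [row]

lemma path_of_le {j y : ℤ} (h : 2 * j + 2 ≤ y) (s : Config) :
    path j s y = chi (path j s (y - 1)) (path (j + 1) s y) (path (j + 1) s (y + 1)) := by
  obtain ⟨i, rfl⟩ : ∃ i : ℕ, y = 2 * j + 2 + i := ⟨(y - 2 * j - 2).toNat, by omega⟩
  have h0 := path_add j (i + 2) s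
  have h1 := path_add j (i + 1) s
  have h2 := path_add (j + 1) i s
  have h3 := path_add (j + 1) (i + 1) s
  push_cast at h0 h1 h2 h3
  rw [show 2 * j + 2 + (i : ℤ) = 2 * j + (i + 2) by ring, h0,
    show 2 * j + ((i : ℤ) + 2) - 1 = 2 * j + (i + 1) by ring, h1,
    show 2 * j + ((i : ℤ) + 2) = 2 * (j + 1) + i by ring, h2,
    show 2 * (j + 1) + (i : ℤ) + 1 = 2 * (j + 1) + (i + 1) by ring, h3, row]

lemma row_congr {j : ℤ} {s s' : Config} (h : ∀ y, 2 * j ≤ y → s y = s' y) (i : ℕ) :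
    row i j s = row i j s' := by
  induction i using Nat.strong_induction_on generalizing j with
  | _ i ih =>
    match i, ih with
    | 0, _ => exact h _ le_rfl
    | 1, _ => exact h _ (by omega)
    | i + 2, ih =>
      simp only [row]
      rw [ih (i + 1) (by omega) h, ih i (by omega) fun y hy => h y (by omega),
        ih (i + 1) (by omega) fun y hy => h y (by omega)]

lemma continuous_row (i : ℕ) (j : ℤ) : Continuous (row i j) := by
  induction i using Nat.strong_induction_on generalizing j with
  | _ i ih =>
    match i, ih with
    | 0, _ => exact continuous_apply _
    | 1, _ => exact continuous_apply _
    | i + 2, ih =>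
      exact continuous_chi_comp (ih _ (by omega) _) (ih _ (by omega) _) (ih _ (by omega) _)

@[fun_prop] lemma continuous_path (j : ℤ) : Continuous (path j) := by
  refine continuous_pi fun y => ?_
  unfold path
  split_ifs
  · exact continuous_apply _
  · exact continuous_row _ _

/-- The space-time lattice is made up of the light-like rows. -/
lemma evolve_eq_path (t : ℕ) (j : ℤ) (s : Config) :
    evolve t s (2 * j + t) = path j s (2 * j + t) ∧
      evolve t s (2 * j + t + 1) = path j s (2 * j + t + 1) := by
  induction t generalizing j with
  | zero => simp [evolve, path_of_lt]
  | succ t ih =>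
    have key : evolve (t + 1) s (2 * j + t + 2) =
        chi (evolve t s (2 * j + t + 1)) (evolve t s (2 * j + t + 2))
          (evolve t s (2 * j + t + 3)) := by
      have e1 : 2 * j + (t : ℤ) + 2 - 1 = 2 * j + t + 1 := by ring
      have e2 : 2 * j + (t : ℤ) + 2 + 1 = 2 * j + t + 3 := by ring
      have hp : Even (2 * j + (t : ℤ) + 2) ↔ Even t := by
        rw [← Int.even_coe_nat t]; simp [parity_simps]
      by_cases ht : Even t
      · simp [evolve, ht, stepEven, hp, e1, e2]
      · simp only [evolve, ht, stepOdd, hp, if_false, e1, e2]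
    have keep : evolve (t + 1) s (2 * j + t + 1) = evolve t s (2 * j + t + 1) := by
      have hp : Even (2 * j + (t : ℤ) + 1) ↔ ¬ Even t := by
        rw [← Int.even_coe_nat t, Int.even_add_one, Int.even_add]; simp
      by_cases ht : Even t
      · simp [evolve, ht, stepEven, hp]
      · simp [evolve, ht, stepOdd, hp]
    have h1 := (ih (j + 1)).1
    have h2 := (ih (j + 1)).2
    rw [show 2 * (j + 1) + (t : ℤ) = 2 * j + t + 2 by ring] at h1 h2
    rw [show 2 * j + (t : ℤ) + 2 + 1 = 2 * j + t + 3 by ring] at h2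
    push_cast
    rw [show 2 * j + ((t : ℤ) + 1) = 2 * j + t + 1 by ring,
      show 2 * j + (t : ℤ) + 1 + 1 = 2 * j + t + 2 by ring]
    refine ⟨by rw [keep, (ih j).2], ?_⟩
    rw [key, path_of_le (by omega) s, (ih j).2, h1, h2,
      show 2 * j + (t : ℤ) + 2 - 1 = 2 * j + t + 1 by ring,
      show 2 * j + (t : ℤ) + 2 + 1 = 2 * j + t + 3 by ring]

/-! ### Sweeps -/

/-- The successive updates of the `n` sites `a, a + 1, …, a + n - 1`. -/
def sweep (a : ℤ) : ℕ → Config → Config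
  | 0, c => c
  | n + 1, c => updateSite (a + n) (sweep a n c)

lemma measurePreserving_sweep (a : ℤ) (n : ℕ) :
    MeasurePreserving (sweep a n) maxEntropyState maxEntropyState := by
  induction n with
  | zero => exact MeasurePreserving.id _
  | succ n ih => exact (measurePreserving_updateSite _).comp ih

lemma continuous_sweep (a : ℤ) (n : ℕ) : Continuous (sweep a n) := by
  induction n with
  | zero => exact continuous_id
  | succ n ih => exact (continuous_updateSite _).comp ih

lemma sweep_of_lt {a y : ℤ} (n : ℕ) (h : y < a) (c : Config) : sweep a n c y = c y := by
  induction n with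
  | zero => rfl
  | succ n ih => rw [sweep, updateSite_of_ne (by omega), ih]

lemma sweep_of_ge {a y : ℤ} {n : ℕ} (h : a + n ≤ y) (c : Config) : sweep a n c y = c y := by
  induction n with
  | zero => rfl
  | succ n ih =>
    push_cast at h
    rw [sweep, updateSite_of_ne (by omega), ih (by omega)]

lemma sweep_of_mem {a y : ℤ} {n : ℕ} (h : a ≤ y) (h' : y < a + n) (c : Config) :
    sweep a n c y = chi (sweep a n c (y - 1)) (c y) (c (y + 1)) := by
  induction n with
  | zero => simp at h'; omega
  | succ n ih =>
    push_cast at h'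
    rw [sweep, updateSite_of_ne (show y - 1 ≠ a + n by omega)]
    by_cases hy : y = a + n
    · subst hy
      rw [updateSite_self, sweep_of_ge le_rfl, sweep_of_ge (y := a + n + 1) (by omega)]
    · rw [updateSite_of_ne hy, ih (by omega)]

/-- A left-to-right sweep reads only one old site to the right of the site it updates, so
information moves leftwards by a single site. -/
lemma sweep_congr {a : ℤ} {n : ℕ} {z : ℤ} {c c' : Config} (h : ∀ y ≤ z, c y = c' y) {y : ℤ}
    (hy : y < z) : sweep a n c y = sweep a n c' y := by
  rcases lt_or_ge y a with hya | hya
  · rw [sweep_of_lt n hya, sweep_of_lt n hya, h y hy.le]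
  rcases lt_or_ge y (a + n) with hyn | hyn
  · obtain ⟨i, rfl⟩ : ∃ i : ℕ, y = a + i := ⟨(y - a).toNat, by omega⟩
    induction i with
    | zero =>
      rw [sweep_of_mem hya hyn, sweep_of_mem hya hyn, sweep_of_lt n (by simp),
        sweep_of_lt n (by simp), h _ (by omega), h _ (by omega), h _ (by omega)]
    | succ i ih =>
      push_cast at hy hya hyn ⊢
      rw [sweep_of_mem (by omega) hyn, sweep_of_mem (by omega) hyn,
        show a + ((i : ℤ) + 1) - 1 = a + i by ring, ih (by omega) (by omega) (by omega),
        h _ (by omega), h _ (by omega)]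
  · rw [sweep_of_ge hyn, sweep_of_ge hyn, h y hy.le]

/-- A sweep carries one light-like row into the next one. -/
lemma sweep_path (j : ℤ) (n : ℕ) (s : Config) {y : ℤ} (hy : y < 2 * j + 2 + n) :
    sweep (2 * j + 2) n (path (j + 1) s) y = path j s y := by
  have h0 {y : ℤ} (hy : y < 2 * j + 2) : sweep (2 * j + 2) n (path (j + 1) s) y = path j s y := by
    rw [sweep_of_lt n hy, path_of_lt (by omega), path_of_lt (by omega)]
  rcases lt_or_ge y (2 * j + 2) with hya | hya
  · exact h0 hya
  obtain ⟨i, rfl⟩ : ∃ i : ℕ, y = 2 * j + 2 + i := ⟨(y - (2 * j + 2)).toNat, by omega⟩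
  induction i with
  | zero => rw [sweep_of_mem hya hy, path_of_le hya, h0 (by simp)]
  | succ i ih =>
    push_cast at hy hya ⊢
    rw [sweep_of_mem (by omega) hy, path_of_le (j := j) (by omega),
      show 2 * j + 2 + ((i : ℤ) + 1) - 1 = 2 * j + 2 + i by ring, ih (by omega) (by omega)]

/-- The successive sweeps that carry the initial configuration into the first `N + 1` sites of a
light-like row. -/
def triangle : ℤ → ℕ → Config → Config
  | _, 0, s => s
  | j, N + 1, s => sweep (2 * j + 2) N (triangle (j + 1) N s)

lemma measurePreserving_triangle (j : ℤ) (N : ℕ) :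
    MeasurePreserving (triangle j N) maxEntropyState maxEntropyState := by
  induction N generalizing j with
  | zero => exact MeasurePreserving.id _
  | succ N ih => exact (measurePreserving_sweep _ _).comp (ih _)

/-- Since `triangle` preserves the measure, any initial part of a path has the uniform product law.
-/
lemma triangle_eq_path (j : ℤ) (N : ℕ) (s : Config) {y : ℤ} (hy : y ≤ 2 * j + N) :
    triangle j N s y = path j s y := by
  induction N generalizing j y with
  | zero => simp at hy; rw [path_of_lt (by omega)]; rfl
  | succ N ih =>
    push_cast at hy
    rw [triangle, sweep_congr (z := 2 * j + 2 + N) (c' := path (j + 1) s)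
      (fun z hz => ih (j + 1) (by omega)) (by omega), sweep_path _ _ _ (by omega)]

/-! ### Vanishing correlations -/

/-- A site of a light-like row is a fair bit, given everything to the left of it. -/
lemma integral_path_eq_zero {j x y : ℤ} (hxy : x < y) (hx : x < 2 * j + 2) {G : Config → ℝ}
    (hGc : Continuous G) (hG : DependsOn G (Set.Iio y)) :
    ∫ s, sgn (s x) * (sgn (path j s y) * G (path j s)) ∂maxEntropyState = 0 := by
  set N := (y - 2 * j).toNat
  have h (s : Config) : sgn (s x) * (sgn (path j s y) * G (path j s)) =
      (fun c : Config => sgn (c x) * (sgn (c y) * G c)) (triangle j N s) := by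
    have h1 : G (triangle j N s) = G (path j s) :=
      hG fun z hz => triangle_eq_path j N s (by simp at hz; omega)
    simp only [h1]
    rw [triangle_eq_path j N s (by omega), triangle_eq_path j N s (by omega), path_of_lt hx]
  have hf : Continuous fun c : Config => sgn (c x) * (sgn (c y) * G c) :=
    (continuous_sgn_site continuous_id x).mul ((continuous_sgn_site continuous_id y).mul hGc)
  have hT := integral_map (measurePreserving_triangle j N).measurable.aemeasurable
    (hf.measurable.aestronglyMeasurable (μ := maxEntropyState.map (triangle j N)))
  simp only [h, ← hT, (measurePreserving_triangle j N).map_eq]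
  refine integral_eq_zero_of_flipSite y fun s => ?_
  have h1 : G (flipSite y s) = G s := hG fun z hz => flipSite_of_ne (by simp at hz; omega) s
  rw [h1, flipSite_self, flipSite_of_ne hxy.ne, sgn_add_one]
  ring

/-- The forbidden pattern 0, 1 in one row forces an occupied site in the next, whatever its left
neighbour. This is what makes the factors 1 + sgn below vanish on the pattern. -/
lemma chi_zero_one (a : ZMod 2) : chi a 0 1 = 1 := by revert a; decide

/-- Let r₁ = chi r₀ c₁ c₂. If r₁ = 0 the outer value is c₂ + c₃; if r₁ = 1 it is 1 + c₂. In the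
latter case only r₀ = 1 contributes, and then r₁ = 1 means c₁ = 0, a condition free of c₂. -/
lemma sgn_chi_chi_mul (r₀ c₁ c₂ c₃ : ZMod 2) (g g' : ℝ)
    (h : chi r₀ c₁ c₂ = 1 → r₀ = 0 → g = 0) (h' : chi r₀ c₁ c₂ = 1 → g' = g) :
    sgn (chi (chi r₀ c₁ c₂) c₂ c₃) * g =
      sgn c₃ * (sgn c₂ * ((1 + sgn (chi r₀ c₁ c₂)) / 2 * g)) +
        sgn c₂ * (-((1 + sgn c₁) / 2 * ((1 - sgn r₀) / 2)) * g') := by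
  rcases bit_cases r₀ with rfl | rfl <;> rcases bit_cases c₁ with rfl | rfl <;>
    rcases bit_cases c₂ with rfl | rfl <;> rcases bit_cases c₃ with rfl | rfl <;>
    simp [chi, bit_one_add_one] at h h' ⊢ <;> simp [h, h']

/-- Besides the same two cases, this uses that c₂ = 1 forces r₁ = 1 + c₁, so that sgn r₁ + sgn c₁ is
unchanged by the factor sgn c₂. -/
lemma two_mul_sgn_chi_chi (r₀ c₁ c₂ c₃ : ZMod 2) :
    2 * sgn (chi (chi r₀ c₁ c₂) c₂ c₃) - sgn (chi r₀ c₁ c₂) - sgn c₁ =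
      sgn c₃ * (sgn c₂ * (1 + sgn (chi r₀ c₁ c₂))) - sgn c₂ * (1 + sgn c₁) := by
  rcases bit_cases r₀ with rfl | rfl <;> rcases bit_cases c₁ with rfl | rfl <;>
    rcases bit_cases c₂ with rfl | rfl <;> rcases bit_cases c₃ with rfl | rfl <;>
    simp [chi, bit_one_add_one] <;> norm_num

lemma two_mul_sgn_chi (r₁ c₂ c₃ : ZMod 2) :
    2 * sgn (chi r₁ c₂ c₃) + sgn c₂ + sgn c₃ - sgn c₂ * sgn r₁ + sgn c₂ * sgn c₃ =
      sgn c₃ * (sgn c₂ * (1 + sgn r₁) + (1 + sgn c₂)) := by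
  rcases bit_cases r₁ with rfl | rfl <;>
    rcases bit_cases c₂ with rfl | rfl <;> rcases bit_cases c₃ with rfl | rfl <;>
    simp [chi, bit_one_add_one] <;> norm_num

/-- In the light-like rows above the source `x`, and to the right of it, a site is uncorrelated
with the source unless it is preceded by an empty and an occupied site. -/
theorem integral_path_eq_zero_of_pattern {x j₀ : ℤ} (hx : 2 * j₀ ≤ x) (hx' : x < 2 * j₀ + 2)
    (k : ℕ) {y : ℤ} (hxy : x < y) {G : Config → ℝ} (hGc : Continuous G)
    (hGd : DependsOn G (Set.Iio y))
    (hG : ∀ c : Config, 2 * (j₀ - k) + 2 ≤ y → c (y - 1) = 1 → c (y - 2) = 0 → G c = 0) :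
    ∫ s, sgn (s x) * (sgn (path (j₀ - k) s y) * G (path (j₀ - k) s)) ∂maxEntropyState = 0 := by
  induction k generalizing y G with
  | zero => exact integral_path_eq_zero hxy (by simpa using hx') hGc hGd
  | succ k ih =>
    set j : ℤ := j₀ - ((k + 1 : ℕ) : ℤ) with hj
    have hj1 : j₀ - (k : ℤ) = j + 1 := by rw [hj]; push_cast; ring
    rw [hj1] at ih
    push_cast at hj
    set n := (y - (2 * j + 2)).toNat with hn
    have hy : y = 2 * j + 2 + n := by omega
    let Φ := sweep (2 * j + 2) n
    have hΦ : Continuous Φ := continuous_sweep _ _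
    -- `H₁` and `H₂` are the weights in the previous row for an empty and an occupied site `y - 1`
    -- of the new row. Overwriting that site by 1 in `H₂` frees `G` of the old bit at `y`.
    let H₁ : Config → ℝ := fun c => sgn (c y) * ((1 + sgn (Φ c (y - 1))) / 2 * G (Φ c))
    let H₂ : Config → ℝ := fun c => -((1 + sgn (c (y - 1))) / 2 * ((1 - sgn (Φ c (y - 2))) / 2)) *
      G (Function.update (Φ c) (y - 1) 1)
    have hH₁ : Continuous H₁ := by
      refine (continuous_sgn_site continuous_id y).mul (Continuous.mul ?_ (hGc.comp hΦ))
      exact (continuous_const.add (continuous_sgn_site hΦ _)).div_const _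
    have hH₂ : Continuous H₂ := by
      refine Continuous.mul (Continuous.neg (Continuous.mul ?_ ?_))
        (hGc.comp (hΦ.update _ continuous_const))
      · exact (continuous_const.add (continuous_sgn_site continuous_id _)).div_const _
      · exact (continuous_const.sub (continuous_sgn_site hΦ _)).div_const _
    have hcong {c c' : Config} (h : ∀ z ≤ y, c z = c' z) : G (Φ c) = G (Φ c') :=
      hGd fun z hz => sweep_congr h hz
    have hd₁ : DependsOn H₁ (Set.Iio (y + 1)) := by
      intro c c' h
      have h' : ∀ z ≤ y, c z = c' z := fun z hz => h z (by simp; omega)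
      have e1 : Φ c (y - 1) = Φ c' (y - 1) := sweep_congr h' (by omega)
      simp only [H₁, h' y le_rfl, hcong h', e1]
    have hd₂ : DependsOn H₂ (Set.Iio y) := by
      intro c c' h
      have h' : ∀ z ≤ y - 1, c z = c' z := fun z hz => h z (by simp; omega)
      have e1 : Φ c (y - 2) = Φ c' (y - 2) := sweep_congr h' (by omega)
      have e2 : G (Function.update (Φ c) (y - 1) 1) = G (Function.update (Φ c') (y - 1) 1) := by
        refine hGd fun z hz => ?_
        by_cases hzy : z = y - 1
        · subst hzy; simp
        · simp only [Function.update_of_ne hzy]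
          exact sweep_congr h' (by simp at hz; omega)
      simp only [H₂, h' (y - 1) le_rfl, e1, e2]
    have hmem (c : Config) : Φ c (y - 1) = chi (Φ c (y - 2)) (c (y - 1)) (c y) := by
      have := sweep_of_mem (a := 2 * j + 2) (n := n) (y := y - 1) (by omega) (by omega) c
      rwa [show y - 1 - 1 = y - 2 by ring, sub_add_cancel] at this
    have i₁ := ih (y := y + 1) (by omega) hH₁ hd₁ fun c _ h1 h0 => by
      rw [add_sub_cancel_right] at h1
      rw [show y + 1 - 2 = y - 1 by ring] at h0
      have : Φ c (y - 1) = 1 := by rw [hmem, h0, h1, chi_zero_one]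
      simp [H₁, this]
    have i₂ := ih hxy hH₂ hd₂ fun c _ h1 _ => by simp [H₂, h1]
    have hsplit (s : Config) : sgn (s x) * (sgn (path j s y) * G (path j s)) =
        sgn (s x) * (sgn (path (j + 1) s (y + 1)) * H₁ (path (j + 1) s)) +
          sgn (s x) * (sgn (path (j + 1) s y) * H₂ (path (j + 1) s)) := by
      have hr {z : ℤ} (hz : z < y) : Φ (path (j + 1) s) z = path j s z :=
        sweep_path j n s (by omega)
      have hGr : G (Φ (path (j + 1) s)) = G (path j s) := hGd fun z hz => hr hz
      have e1 : path j s (y - 1) =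
          chi (path j s (y - 2)) (path (j + 1) s (y - 1)) (path (j + 1) s y) := by
        rw [← hr (show y - 1 < y by omega), ← hr (show y - 2 < y by omega), hmem]
      have e2 := path_of_le (j := j) (y := y) (by omega) s
      rw [← mul_add]
      congr 1
      simp only [H₁, H₂, hGr, hr (show y - 1 < y by omega), hr (show y - 2 < y by omega)]
      rw [e2, e1]
      refine sgn_chi_chi_mul _ _ _ _ _ _ (fun h1 h0 => ?_) (fun h1 => ?_)
      · exact hG _ (by omega) (e1.trans h1) h0
      · refine hGd fun z hz => ?_
        by_cases hzy : z = y - 1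
        · subst hzy; simp [e1, h1]
        · simp only [Function.update_of_ne hzy]
          exact hr hz
    have hint {z : ℤ} {H : Config → ℝ} (hH : Continuous H) : Integrable (fun s =>
        sgn (s x) * (sgn (path (j + 1) s z) * H (path (j + 1) s))) maxEntropyState :=
      continuous_integrable <| (continuous_sgn_site continuous_id x).mul <|
        (continuous_sgn_site (continuous_path _) z).mul (hH.comp (continuous_path _))
    simp only [hsplit]
    rw [integral_add (hint hH₁) (hint hH₂), i₁, i₂, add_zero]

/-! ### Recursions for the correlations with the source -/

/-- The correlation of `f` with the sign of the initial value at the site `x`. -/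
noncomputable def sourceCorr (x : ℤ) (f : Config → ℝ) : ℝ :=
  ∫ s, sgn (s x) * f s ∂maxEntropyState

lemma integrable_source_mul (x : ℤ) {f : Config → ℝ} (hf : Continuous f) :
    Integrable (fun s : Config => sgn (s x) * f s) maxEntropyState :=
  continuous_integrable ((continuous_sgn_site continuous_id x).mul hf)

lemma sourceCorr_add (x : ℤ) {f g : Config → ℝ} (hf : Continuous f) (hg : Continuous g) :
    sourceCorr x (fun s => f s + g s) = sourceCorr x f + sourceCorr x g := by
  simp only [sourceCorr, mul_add]
  exact integral_add (integrable_source_mul x hf) (integrable_source_mul x hg)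

lemma sourceCorr_const_mul (x : ℤ) (a : ℝ) (f : Config → ℝ) :
    sourceCorr x (fun s => a * f s) = a * sourceCorr x f := by
  simp only [sourceCorr, mul_left_comm _ a]
  exact integral_const_mul _ _

lemma sourceCorr_sub (x : ℤ) {f g : Config → ℝ} (hf : Continuous f) (hg : Continuous g) :
    sourceCorr x (fun s => f s - g s) = sourceCorr x f - sourceCorr x g := by
  simp only [sourceCorr, mul_sub]
  exact integral_sub (integrable_source_mul x hf) (integrable_source_mul x hg)

/-- The correlation between the source `x` and the site `y` of the `k`-th row above it. -/
noncomputable def rowCorr (x : ℤ) (k : ℕ) (y : ℤ) : ℝ :=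
  sourceCorr x fun s => sgn (path (x / 2 - k) s y)

lemma rowCorr_zero_self (x : ℤ) : rowCorr x 0 x = 1 := by
  have h (s : Config) : sgn (s x) * sgn (path (x / 2 - (0 : ℕ)) s x) = 1 := by
    rw [path_of_lt (by push_cast; omega), sgn_mul_self]
  unfold rowCorr sourceCorr
  simp only [h]
  simp

lemma rowCorr_zero_of_lt {x y : ℤ} (h : x < y) : rowCorr x 0 y = 0 := by
  have := integral_path_eq_zero (j := x / 2 - (0 : ℕ)) h (by push_cast; omega)
    (G := fun _ => 1) continuous_const (fun _ _ _ => rfl)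
  simp only [mul_one] at this
  exact this

lemma sourceCorr_eq_zero_of_pattern (x : ℤ) (k : ℕ) {y : ℤ} (hxy : x < y) {G : Config → ℝ}
    (hGc : Continuous G) (hGd : DependsOn G (Set.Iio y))
    (hG : ∀ c : Config, 2 * (x / 2 - k) + 2 ≤ y → c (y - 1) = 1 → c (y - 2) = 0 → G c = 0) :
    sourceCorr x (fun s => sgn (path (x / 2 - k) s y) * G (path (x / 2 - k) s)) = 0 :=
  integral_path_eq_zero_of_pattern (by omega) (by omega) k hxy hGc hGd hG

/-- Both terms on the right of `two_mul_sgn_chi_chi` are uncorrelated with the source by the pattern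
lemma. -/
theorem rowCorr_succ_of_lt {x y : ℤ} (k : ℕ) (hxy : x < y) :
    2 * rowCorr x (k + 1) y - rowCorr x (k + 1) (y - 1) = rowCorr x k (y - 1) := by
  unfold rowCorr
  set j : ℤ := x / 2 - ((k + 1 : ℕ) : ℤ) with hj
  have hj1 : x / 2 - (k : ℤ) = j + 1 := by rw [hj]; push_cast; ring
  push_cast at hj
  set n := (y - (2 * j + 2)).toNat with hn
  let Φ := sweep (2 * j + 2) n
  have hΦ : Continuous Φ := continuous_sweep _ _
  have hmem (c : Config) : Φ c (y - 1) = chi (Φ c (y - 2)) (c (y - 1)) (c y) := by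
    have := sweep_of_mem (a := 2 * j + 2) (n := n) (y := y - 1) (by omega) (by omega) c
    rwa [show y - 1 - 1 = y - 2 by ring, sub_add_cancel] at this
  let H₁ : Config → ℝ := fun c => sgn (c y) * (1 + sgn (Φ c (y - 1)))
  let H₂ : Config → ℝ := fun c => 1 + sgn (c (y - 1))
  have hH₁ : Continuous H₁ := (continuous_sgn_site continuous_id y).mul
    (continuous_const.add (continuous_sgn_site hΦ _))
  have hH₂ : Continuous H₂ := continuous_const.add (continuous_sgn_site continuous_id _)
  have hd₁ : DependsOn H₁ (Set.Iio (y + 1)) := fun c c' h => by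
    have h' : ∀ z ≤ y, c z = c' z := fun z hz => h z (by simp; omega)
    have e1 : Φ c (y - 1) = Φ c' (y - 1) := sweep_congr h' (by omega)
    simp only [H₁, h' y le_rfl, e1]
  have hd₂ : DependsOn H₂ (Set.Iio y) := fun c c' h => by
    simp only [H₂, h (y - 1) (by simp)]
  have i₁ := sourceCorr_eq_zero_of_pattern x k (y := y + 1) (by omega) hH₁ hd₁ fun c _ h1 h0 => by
    rw [add_sub_cancel_right] at h1
    rw [show y + 1 - 2 = y - 1 by ring] at h0
    have : Φ c (y - 1) = 1 := by rw [hmem, h0, h1, chi_zero_one]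
    simp [H₁, this]
  have i₂ := sourceCorr_eq_zero_of_pattern x k hxy hH₂ hd₂ fun c _ h1 _ => by simp [H₂, h1]
  rw [hj1] at i₁ i₂ ⊢
  have key : (fun s => 2 * sgn (path j s y) - sgn (path j s (y - 1)) -
      sgn (path (j + 1) s (y - 1))) = fun s =>
      sgn (path (j + 1) s (y + 1)) * H₁ (path (j + 1) s) -
        sgn (path (j + 1) s y) * H₂ (path (j + 1) s) := by
    funext s
    have e1 : Φ (path (j + 1) s) (y - 1) = path j s (y - 1) := sweep_path j n s (by omega)
    have e2 : Φ (path (j + 1) s) (y - 2) = path j s (y - 2) := sweep_path j n s (by omega)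
    have e3 := hmem (path (j + 1) s)
    rw [e1, e2] at e3
    have e4 := path_of_le (j := j) (y := y) (by omega) s
    simp only [H₁, H₂, e1]
    rw [e4, e3]
    exact two_mul_sgn_chi_chi _ _ _ _
  have := congrArg (sourceCorr x) key
  have hc₁ := hH₁.comp (continuous_path (j + 1))
  have hc₂ := hH₂.comp (continuous_path (j + 1))
  simp only [Function.comp_def] at hc₁ hc₂
  rw [sourceCorr_sub, sourceCorr_sub, sourceCorr_const_mul, sourceCorr_sub, i₁, i₂] at this
  any_goals fun_prop
  linarith

/-- At y = x the pattern lemma applies only to terms carrying the sign at x + 1. The remaining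
product with the new site x - 1 is turned into such a term by reflection. -/
theorem rowCorr_succ_self (x : ℤ) (k : ℕ) :
    2 * rowCorr x (k + 1) x = -rowCorr x k x - rowCorr x k (x + 1) := by
  unfold rowCorr
  set j : ℤ := x / 2 - ((k + 1 : ℕ) : ℤ) with hj
  have hj1 : x / 2 - (k : ℤ) = j + 1 := by rw [hj]; push_cast; ring
  push_cast at hj
  set n := (x - (2 * j + 2)).toNat with hn
  let Φ := sweep (2 * j + 2) n
  have hΦ : Continuous Φ := continuous_sweep _ _
  let H : Config → ℝ := fun c => sgn (c x) * (1 + sgn (Φ c (x - 1))) + (1 + sgn (c x))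
  have hH : Continuous H := ((continuous_sgn_site continuous_id x).mul
    (continuous_const.add (continuous_sgn_site hΦ _))).add
      (continuous_const.add (continuous_sgn_site continuous_id _))
  have hd : DependsOn H (Set.Iio (x + 1)) := fun c c' h => by
    have h' : ∀ z ≤ x, c z = c' z := fun z hz => h z (by simp; omega)
    have e1 : Φ c (x - 1) = Φ c' (x - 1) := sweep_congr h' (by omega)
    simp only [H, h' x le_rfl, e1]
  -- The bound `hy` ensures that the sweep reaches `x - 1`; it fails only for `k = 0` and even `x`,
  -- where no pattern condition is required.
  have i₁ := sourceCorr_eq_zero_of_pattern x k (y := x + 1) (by omega) hH hd fun c hy h1 h0 => by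
    rw [add_sub_cancel_right] at h1
    rw [show x + 1 - 2 = x - 1 by ring] at h0
    have h2 := sweep_of_mem (a := 2 * j + 2) (n := n) (y := x - 1) (by omega) (by omega) c
    rw [sub_add_cancel, h0, h1, chi_zero_one] at h2
    simp [H, Φ, h1, h2]
  rw [hj1] at i₁ ⊢
  -- The sites x - 1 of the new row and x + 1 of the old row belong to the same time slice and are
  -- mirror images about the source.
  have hreflect : sourceCorr x (fun s => sgn (path (j + 1) s x) * sgn (path j s (x - 1))) =
      sourceCorr x (fun s => sgn (path (j + 1) s x) * sgn (path (j + 1) s (x + 1))) := by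
    obtain ⟨T, hT⟩ : ∃ T : ℕ, x = 2 * (j + 1) + T := ⟨(x - 2 * (j + 1)).toNat, by omega⟩
    have e0 (s : Config) : path (j + 1) s x = evolve T s x := by
      rw [hT]; exact (evolve_eq_path T (j + 1) s).1.symm
    have e1 (s : Config) : path (j + 1) s (x + 1) = evolve T s (x + 1) := by
      rw [hT]; exact (evolve_eq_path T (j + 1) s).2.symm
    have e2 (s : Config) : path j s (x - 1) = evolve T s (x - 1) := by
      rw [hT, show 2 * (j + 1) + (T : ℤ) - 1 = 2 * j + T + 1 by ring]
      exact (evolve_eq_path T j s).2.symm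
    unfold sourceCorr
    rw [← integral_reflect x]
    refine integral_congr_ae (Filter.Eventually.of_forall fun s => ?_)
    simp only [e0, e1, e2, evolve_reflect]
    simp only [reflect, show 2 * x - x = x by ring, show 2 * x - (x - 1) = x + 1 by ring]
  have key : (fun s => 2 * sgn (path j s x) + sgn (path (j + 1) s x) +
      sgn (path (j + 1) s (x + 1)) - sgn (path (j + 1) s x) * sgn (path j s (x - 1)) +
      sgn (path (j + 1) s x) * sgn (path (j + 1) s (x + 1))) = fun s =>
      sgn (path (j + 1) s (x + 1)) * H (path (j + 1) s) := by
    funext s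
    have e1 : Φ (path (j + 1) s) (x - 1) = path j s (x - 1) := sweep_path j n s (by omega)
    have e4 := path_of_le (j := j) (y := x) (by omega) s
    simp only [H, e1]
    rw [e4]
    exact two_mul_sgn_chi _ _ _
  have := congrArg (sourceCorr x) key
  rw [sourceCorr_add, sourceCorr_sub, sourceCorr_add, sourceCorr_add, sourceCorr_const_mul,
    hreflect, i₁] at this
  any_goals fun_prop
  linarith

/-! ### The rescaled correlations -/

/-- The rescaled correlations in the homogeneous regime, by their recursion. -/
noncomputable def homSeq : ℕ → ℝ
  | 0 => 1 / 2
  | 1 => 0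
  | n + 2 => -homSeq (n + 1) - 2 * homSeq n

/-- This reflects z³ - z² - 4 = (z - 2)(z² + z + 2). -/
lemma homSeq_add_three (n : ℕ) : homSeq (n + 3) = homSeq (n + 2) + 4 * homSeq n := by
  rw [homSeq, homSeq]; ring

/-- The rescaled correlations on the `k`-th ray, at distance `i` from the first node. -/
noncomputable def rayValue (k i : ℕ) : ℝ :=
  ∑ j ∈ Finset.range k, (i.choose j : ℝ) * 4 ^ j * homSeq (2 * k + 1 - 2 * j)

lemma rayValue_zero_right (k : ℕ) : rayValue k 0 = homSeq (2 * k + 1) := by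
  cases k with
  | zero => simp [rayValue, homSeq]
  | succ k => simp [rayValue, Finset.sum_range_succ']

/-- Pascal's rule; the `homSeq` index depends only on k - j, so shifting j lowers k. -/
lemma rayValue_succ_succ (k i : ℕ) :
    rayValue (k + 1) (i + 1) = rayValue (k + 1) i + 4 * rayValue k i := by
  unfold rayValue
  rw [Finset.sum_range_succ', Finset.sum_range_succ' _ k, Finset.mul_sum, add_right_comm,
    ← Finset.sum_add_distrib]
  congr 1
  · refine Finset.sum_congr rfl fun j _ => ?_
    rw [Nat.choose_succ_succ, show 2 * (k + 1) + 1 - 2 * (j + 1) = 2 * k + 1 - 2 * j by omega]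
    push_cast
    ring
  · simp

/-- Both sides obey the same recursion, and i ≤ k keeps it from descending below k = 0 before i
reaches 0. -/
lemma rayValue_eq_homSeq {k i : ℕ} (h : i ≤ k) : rayValue k i = homSeq (2 * k + 1 + i) := by
  induction i generalizing k with
  | zero => exact rayValue_zero_right k
  | succ i ih =>
    obtain ⟨k, rfl⟩ : ∃ k', k = k' + 1 := ⟨k - 1, by omega⟩
    rw [rayValue_succ_succ, ih (by omega), ih (by omega),
      show 2 * (k + 1) + 1 + (i + 1) = 2 * k + 1 + i + 3 by ring, homSeq_add_three,
      show 2 * (k + 1) + 1 + i = 2 * k + 1 + i + 2 by ring]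

/-- Row 0 carries correlation 1 at the source and 0 to its right; the two recursions propagate this
upwards and then along each row. -/
theorem rowCorr_eq (x : ℤ) (k : ℕ) :
    (2 : ℝ) ^ (2 * k) * rowCorr x k x = 2 * homSeq (2 * k) ∧
      ∀ i : ℕ, (2 : ℝ) ^ (2 * k + i) * rowCorr x k (x + 1 + i) = rayValue k i := by
  induction k with
  | zero =>
    refine ⟨by simp [rowCorr_zero_self, homSeq], fun i => ?_⟩
    rw [rowCorr_zero_of_lt (by omega)]
    simp [rayValue]
  | succ k ih =>
    obtain ⟨ih₀, ih₁⟩ := ih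
    have h0 := ih₁ 0
    rw [rayValue_zero_right] at h0
    simp only [Nat.cast_zero, add_zero] at h0
    have hdiag : (2 : ℝ) ^ (2 * (k + 1)) * rowCorr x (k + 1) x = 2 * homSeq (2 * (k + 1)) := by
      have hd := rowCorr_succ_self x k
      rw [show 2 * (k + 1) = 2 * k + 2 by ring, homSeq, pow_add]
      linear_combination (2 * 2 ^ (2 * k)) * hd - 2 * ih₀ - 2 * h0
    refine ⟨hdiag, fun i => ?_⟩
    induction i with
    | zero =>
      have hr := rowCorr_succ_of_lt (x := x) (y := x + 1) k (by omega)
      rw [add_sub_cancel_right] at hr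
      -- Next to the source the recursion involves only the two source columns, rescaled to 2 *
      -- homSeq (2k+2) and 2 * homSeq (2k).
      rw [rayValue_zero_right, show 2 * (k + 1) + 1 = 2 * k + 3 by ring, homSeq_add_three]
      rw [show 2 * (k + 1) = 2 * k + 2 by ring] at hdiag ⊢
      simp only [Nat.cast_zero, add_zero]
      rw [pow_add] at hdiag ⊢
      linear_combination (2 * 2 ^ (2 * k)) * hr + hdiag / 2 + 2 * ih₀
    | succ i ihi =>
      have hr := rowCorr_succ_of_lt (x := x) (y := x + 1 + (i + 1 : ℕ)) k (by omega)
      rw [show x + 1 + ((i + 1 : ℕ) : ℤ) - 1 = x + 1 + i by push_cast; ring] at hr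
      rw [rayValue_succ_succ, ← ihi, ← ih₁ i]
      rw [show 2 * (k + 1) + (i + 1) = 2 * k + i + 3 by ring,
        show 2 * (k + 1) + i = 2 * k + i + 2 by ring, pow_add, pow_add _ _ 2]
      linear_combination (4 * 2 ^ (2 * k + i)) * hr

/-! ### The dynamic structure factor -/

lemma continuous_evolve (t : ℕ) : Continuous (evolve t) := by
  induction t with
  | zero => exact continuous_id
  | succ t ih =>
    have h (y : ℤ) : Continuous fun s => evolve t s y := (continuous_apply y).comp ih
    simp only [evolve]
    split_ifs <;> refine continuous_pi fun y => ?_ <;> simp only [stepEven, stepOdd] <;>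
      split_ifs <;> first | exact h _ | exact continuous_chi_comp (h _) (h _) (h _)

/-- The source sign has mean zero, so the mean of the evolved sign cancels without being computed.
-/
lemma structureFactor_eq (x : ℤ) (t : ℕ) :
    structureFactor x t = sourceCorr x (fun s => sgn (evolve t s 0)) / 4 := by
  have hx : Continuous fun s : Config => sgn (s x) := continuous_sgn_site continuous_id x
  have ht : Continuous fun s => sgn (evolve t s 0) := continuous_sgn_site (continuous_evolve t) 0
  have h0 : ∫ s : Config, sgn (s x) ∂maxEntropyState = 0 :=
    integral_eq_zero_of_flipSite x fun s => by rw [flipSite_self, sgn_add_one]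
  have e1 (s : Config) : (1 - sgn (s x)) / 2 * ((1 - sgn (evolve t s 0)) / 2) =
      ((1 - sgn (s x)) - sgn (evolve t s 0) + sgn (s x) * sgn (evolve t s 0)) / 4 := by ring
  simp only [structureFactor, timeEvolved, site_one_eq, e1, integral_div, sourceCorr]
  rw [integral_add, integral_sub, integral_sub, integral_sub, h0]
  any_goals exact continuous_integrable (by fun_prop)
  simp
  ring

lemma structureFactor_neg (x : ℤ) (t : ℕ) : structureFactor (-x) t = structureFactor x t := by
  rw [structureFactor_eq, structureFactor_eq]
  congr 1
  unfold sourceCorr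
  rw [← integral_reflect 0]
  simp [evolve_reflect, reflect]

lemma structureFactor_neg_abs (x : ℤ) (t : ℕ) :
    structureFactor (-|x|) t = structureFactor x t := by
  rcases abs_choice x with h | h <;> rw [h]
  · exact structureFactor_neg x t
  · rw [neg_neg]

lemma evolve_zero_eq_path {x k : ℤ} {t : ℕ} (h : t + x = 2 * k) (s : Config) :
    evolve t s 0 = path (x / 2 - k) s 0 := by
  have := evolve_eq_path t (x / 2 - k) s
  obtain h0 | h0 : 2 * (x / 2 - k) + (t : ℤ) = 0 ∨ 2 * (x / 2 - k) + (t : ℤ) + 1 = 0 := by omega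
  · rw [h0] at this; exact this.1
  · rw [h0] at this; exact this.2

/-- The structure factor vanishes outside the light cone. -/
theorem structureFactor_eq_zero_of_outside {x : ℤ} {t : ℕ} {k : ℤ} (h : t - |x| = 2 * k) (hk : k < 0) :
    structureFactor x t = 0 := by
  rw [← structureFactor_neg_abs, structureFactor_eq]
  set z := -|x| with hz
  have h0 : sourceCorr z (fun s => sgn (evolve t s 0)) = 0 := by
    refine integral_eq_zero_of_flipSite z fun s => ?_
    simp only [evolve_zero_eq_path (x := z) (k := k) (t := t) (by omega), flipSite_self,
      sgn_add_one]
    have hp : path (z / 2 - k) (flipSite z s) 0 = path (z / 2 - k) s 0 := by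
      unfold path
      rw [row_congr (s := flipSite z s) (s' := s) fun y hy => flipSite_of_ne (by omega) s,
        flipSite_of_ne (by omega)]
    rw [hp]
    ring
  rw [h0, zero_div]

theorem two_pow_mul_structureFactor {x : ℤ} {t k i : ℕ} (hx : |x| = i + 1)
    (h : (t : ℤ) - |x| = 2 * k) :
    (2 : ℝ) ^ (t + 1) * structureFactor x t = rayValue k i := by
  have e := (rowCorr_eq (-|x|) k).2 i
  rw [show -|x| + 1 + (i : ℤ) = 0 by omega] at e
  rw [← structureFactor_neg_abs, structureFactor_eq, ← e, rowCorr,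
    show t + 1 = 2 * k + i + 2 by omega, pow_add]
  simp only [evolve_zero_eq_path (x := -|x|) (k := (k : ℤ)) (t := t) (by omega)]
  ring

/-! ### Interpolation -/

lemma c0_add_two (n : ℤ) : c0 (n + 2) = -c0 (n + 1) - 2 * c0 n := by
  have h7 : ((√7 : ℝ) : ℂ) * ((√7 : ℝ) : ℂ) = 7 := by
    rw [← Complex.ofReal_mul, Real.mul_self_sqrt (by norm_num)]; norm_num
  have hI := Complex.I_mul_I
  have key (r : ℂ) (hr : r ^ 2 = -r - 2) (m : ℤ) : r ^ (m + 2) = -r ^ (m + 1) - 2 * r ^ m := by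
    have h0 : r ≠ 0 := by rintro rfl; norm_num at hr
    rw [zpow_add₀ h0, zpow_add₀ h0, zpow_one, show r ^ (2 : ℤ) = r ^ 2 by norm_cast, hr]
    ring
  have h1 := key ((-1 - Complex.I * (√7 : ℝ)) / 2)
    (by linear_combination (Complex.I * Complex.I / 4) * h7 + 7 / 4 * hI) n
  have h2 := key ((-1 + Complex.I * (√7 : ℝ)) / 2)
    (by linear_combination (Complex.I * Complex.I / 4) * h7 + 7 / 4 * hI) n
  unfold c0
  rw [h1, h2]
  ring

lemma c0_natCast (n : ℕ) : c0 n = (homSeq n : ℂ) := by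
  induction n using Nat.strong_induction_on with
  | _ n ih =>
    match n, ih with
    | 0, _ => simp [c0, homSeq]; ring
    | 1, _ =>
      have h7 : ((√7 : ℝ) : ℂ) ≠ 0 := by
        rw [Complex.ofReal_ne_zero]; positivity
      simp only [c0, homSeq, Nat.cast_one, zpow_one, Complex.ofReal_zero]
      field_simp
      linear_combination (-2 * ((√7 : ℝ) : ℂ)) * Complex.I_mul_I
    | n + 2, ih =>
      have h := c0_add_two n
      have h1 := ih (n + 1) (by omega)
      push_cast at h1 ⊢
      rw [h, h1, ih n (by omega), homSeq]
      push_cast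
      ring

open Polynomial in
/-- The polynomial that describes the rescaled correlations on the `k`-th ray. -/
noncomputable def rayPoly (k : ℕ) : ℝ[X] :=
  ∑ j ∈ Finset.range k, C (4 ^ j * homSeq (2 * k + 1 - 2 * j) / (j.factorial : ℝ)) *
    (descPochhammer ℝ j).comp (X - C (2 * k + 1 : ℝ))

/-- The falling factorial of t - (2k+1) = i, divided by j!, is the binomial of `rayValue`. -/
lemma rayPoly_eval (k i : ℕ) : (rayPoly k).eval ((2 * k + 1 + i : ℕ) : ℝ) = rayValue k i := by
  unfold rayPoly rayValue
  rw [Polynomial.eval_finsetSum]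
  refine Finset.sum_congr rfl fun j _ => ?_
  have h : ((2 * k + 1 + i : ℕ) : ℝ) - (2 * k + 1) = i := by push_cast; ring
  have hj : (j.factorial : ℝ) ≠ 0 := by positivity
  simp only [Polynomial.eval_mul, Polynomial.eval_C, Polynomial.eval_comp, Polynomial.eval_sub,
    Polynomial.eval_X, h, descPochhammer_eval_eq_descFactorial,
    Nat.descFactorial_eq_factorial_mul_choose]
  push_cast
  field_simp

lemma rayPoly_degree_term {a : ℝ} (ha : a ≠ 0) (b : ℝ) (j : ℕ) :
    (Polynomial.C a * (descPochhammer ℝ j).comp (Polynomial.X - Polynomial.C b)).degree = j := by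
  have hm : ((descPochhammer ℝ j).comp (Polynomial.X - Polynomial.C b)).Monic :=
    (monic_descPochhammer ℝ j).comp (Polynomial.monic_X_sub_C b) (by simp)
  rw [Polynomial.degree_C_mul ha, Polynomial.degree_eq_natDegree hm.ne_zero,
    Polynomial.natDegree_comp, descPochhammer_natDegree, Polynomial.natDegree_X_sub_C, mul_one]

/-- The top term survives because `homSeq 3 = 1`; lower coefficients may vanish, which does no harm.
-/
lemma rayPoly_degree (k : ℕ) : (rayPoly (k + 1)).degree = k := by
  have h3 : homSeq (2 * (k + 1) + 1 - 2 * k) = 1 := by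
    rw [show 2 * (k + 1) + 1 - 2 * k = 3 by omega]
    norm_num [homSeq]
  have hk : (4 : ℝ) ^ k * homSeq (2 * (k + 1) + 1 - 2 * k) / (k.factorial : ℝ) ≠ 0 := by
    rw [h3]; positivity
  unfold rayPoly
  rw [Finset.sum_range_succ, Polynomial.degree_add_eq_right_of_degree_lt, rayPoly_degree_term hk]
  rw [rayPoly_degree_term hk]
  refine Polynomial.mem_degreeLT.mp (Submodule.sum_mem _ fun j hj => ?_)
  rw [Polynomial.mem_degreeLT]
  by_cases ha : (4 : ℝ) ^ j * homSeq (2 * (k + 1) + 1 - 2 * j) / (j.factorial : ℝ) = 0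
  · rw [ha, Polynomial.C_0, zero_mul, Polynomial.degree_zero]
    exact WithBot.bot_lt_coe k
  · rw [rayPoly_degree_term ha]
    exact_mod_cast Finset.mem_range.mp hj

lemma rayPoly_eval_node {k : ℕ} {n : ℤ} (hn : n ∈ Finset.Icc (2 * (k : ℤ) + 1) (3 * (k : ℤ))) :
    (((rayPoly k).eval (n : ℝ) : ℝ) : ℂ) = c0 n := by
  rw [Finset.mem_Icc] at hn
  obtain ⟨i, rfl⟩ : ∃ i : ℕ, n = ((2 * k + 1 + i : ℕ) : ℤ) :=
    ⟨(n - (2 * k + 1)).toNat, by push_cast; omega⟩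
  rw [c0_natCast, Int.cast_natCast, rayPoly_eval, rayValue_eq_homSeq (by push_cast at hn; omega)]

lemma sum_nodes_eq_eval {x : ℤ} {t k : ℕ} (hk : 1 ≤ k) (h : (t : ℤ) - |x| = 2 * k) :
    ∑ n ∈ nodes x t, (∏ j ∈ (nodes x t).erase n, ((t : ℂ) - (j : ℂ)) / ((n : ℂ) - (j : ℂ)))
      * c0 n = (((rayPoly k).eval (t : ℝ) : ℝ) : ℂ) := by
  have hnodes : nodes x t = Finset.Icc (2 * (k : ℤ) + 1) (3 * (k : ℤ)) := by
    unfold nodes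
    rw [h]
    congr 1
    omega
  obtain ⟨k, rfl⟩ : ∃ k', k = k' + 1 := ⟨k - 1, by omega⟩
  set P : Polynomial ℂ := (rayPoly (k + 1)).map Complex.ofRealHom with hP
  have hPe (a : ℝ) : P.eval (a : ℂ) = (((rayPoly (k + 1)).eval a : ℝ) : ℂ) := by
    rw [hP]
    exact Polynomial.eval_map_apply Complex.ofRealHom a
  have hinj : Set.InjOn (fun n : ℤ => (n : ℂ)) (nodes x t) := Int.cast_injective.injOn
  have hdeg : P.degree < (nodes x t).card := by
    rw [hP, Polynomial.degree_map, rayPoly_degree, hnodes, Int.card_Icc]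
    rw [Nat.cast_lt]
    omega
  have hinterp := Lagrange.eq_interpolate_of_eval_eq c0 hinj hdeg fun n hn => by
    rw [hnodes] at hn
    rw [← rayPoly_eval_node hn, ← hPe]
    norm_cast
  have := congrArg (Polynomial.eval ((t : ℝ) : ℂ)) hinterp
  rw [hPe, Lagrange.interpolate_apply, Polynomial.eval_finsetSum] at this
  rw [this]
  refine Finset.sum_congr rfl fun n _ => ?_
  rw [Polynomial.eval_mul, Polynomial.eval_C, Lagrange.basis, Polynomial.eval_prod, mul_comm]
  congr 1
  refine Finset.prod_congr rfl fun j _ => ?_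
  simp [Lagrange.basisDivisor, div_eq_inv_mul]

theorem two_pow_mul_structureFactor_eq_eval {x : ℤ} {t k : ℕ} (hx : x ≠ 0)
    (h : (t : ℤ) - |x| = 2 * k) :
    (2 : ℝ) ^ (t + 1) * structureFactor x t = (rayPoly k).eval (t : ℝ) := by
  have hpos := abs_pos.mpr hx
  obtain ⟨i, hi⟩ : ∃ i : ℕ, |x| = i + 1 := ⟨(|x| - 1).toNat, by omega⟩
  rw [two_pow_mul_structureFactor hi h, ← rayPoly_eval, show 2 * k + 1 + i = t by omega]

lemma ne_zero_of_le_abs {x : ℤ} {t : ℕ} (h : ((t : ℝ) + 4) / 3 ≤ |(x : ℝ)|) : x ≠ 0 := by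
  rintro rfl
  rw [Int.cast_zero, abs_zero] at h
  have : (0 : ℝ) ≤ t := t.cast_nonneg
  linarith

end RCA54

theorem mainTheorem6 :
    (∀ (x : ℤ) (t : ℕ), Even (x + (t : ℤ)) → ((t : ℝ) + 4) / 3 ≤ |(x : ℝ)| →
      (2 : ℂ) ^ (t + 1) * (RCA54.structureFactor x t : ℂ) =
        ∑ n ∈ RCA54.nodes x t,
          (∏ j ∈ (RCA54.nodes x t).erase n, ((t : ℂ) - (j : ℂ)) / ((n : ℂ) - (j : ℂ)))
            * RCA54.c0 n) ∧
    (∀ k : ℕ, 1 ≤ k → ∃ P : Polynomial ℝ,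
      P.degree = ((k - 1 : ℕ) : WithBot ℕ) ∧
      (∀ n ∈ Finset.Icc (2 * (k : ℤ) + 1) (3 * (k : ℤ)),
        ((P.eval (n : ℝ) : ℝ) : ℂ) = RCA54.c0 n) ∧
      ∀ (x : ℤ) (t : ℕ), (t : ℤ) - |x| = 2 * (k : ℤ) → ((t : ℝ) + 4) / 3 ≤ |(x : ℝ)| →
        (2 : ℝ) ^ (t + 1) * RCA54.structureFactor x t = P.eval (t : ℝ)) := by
  refine ⟨fun x t hxt hx => ?_, fun k hk => ⟨RCA54.rayPoly k, ?_, fun n hn =>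
    RCA54.rayPoly_eval_node hn, fun x t h hx =>
    RCA54.two_pow_mul_structureFactor_eq_eval (RCA54.ne_zero_of_le_abs hx) h⟩⟩
  · have hx0 := RCA54.ne_zero_of_le_abs hx
    obtain ⟨l, hl⟩ : ∃ l : ℤ, (t : ℤ) - |x| = 2 * l := by
      obtain ⟨m, hm⟩ := hxt
      rcases abs_choice x with h | h <;> rw [h]
      · exact ⟨t - m, by omega⟩
      · exact ⟨m, by omega⟩
    rcases lt_or_ge 0 l with hl0 | hl0
    · lift l to ℕ using hl0.le
      rw [RCA54.sum_nodes_eq_eval (by omega) hl,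
        ← RCA54.two_pow_mul_structureFactor_eq_eval hx0 hl]
      push_cast
      rfl
    · have hnodes : RCA54.nodes x t = ∅ := by
        unfold RCA54.nodes
        rw [hl, Finset.Icc_eq_empty]
        omega
      -- Outside the cone the source cannot influence the row; on its edge, l = 0, the polynomial
      -- `rayPoly 0` is an empty sum.
      have hC : RCA54.structureFactor x t = 0 := by
        rcases hl0.lt_or_eq with hl1 | rfl
        · exact RCA54.structureFactor_eq_zero_of_outside hl hl1
        · have h := RCA54.two_pow_mul_structureFactor_eq_eval (k := 0) hx0 (by simpa using hl)
          simpa [RCA54.rayPoly] using h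
      rw [hnodes, hC]
      simp
  · obtain ⟨k, rfl⟩ : ∃ k', k = k' + 1 := ⟨k - 1, by omega⟩
    exact RCA54.rayPoly_degree k
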